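/- For $f:\{0,1\}^\ell\to\{0,1\}$ write $\Pr[f=1]$ for the probability that $f(x)=1$ when $x\in\{0,1\}^\ell$ is uniformly random. For $B\subseteq[\ell]$ let $f|_B:\{0,1\}^\ell\to\{0,1\}$ be the function with $f|_B(x)=1$ if and only if there is $y\in\{0,1\}^\ell$ with $y_i=x_i$ for all $i\notin B$ and $f(y)=1$ (the players in $B$ choose their bits, towards $1$, after seeing the bits of all other players). We say that $B$ can $p$-bias $f$ towards $1$ if $\Pr[f|_B=1]\ge p$. Below, $\log$ is the natural logarithm. There is a universal constant $C>0$ such that the following holds for every integer $\ell\ge 3$. Let $\mathcal F=(f_j)_{j\in J}$ be any finite family (repetitions allowed) of functions $f_j:\{0,1\}^\ell\to\{0,1\}$ with $\Pr[f_j=1]\ge 0.001$ for every $j\in J$. Then there is a common set $B_R\subseteq[\ell]$ with $$|B_R|\le C\cdot\frac{\ell}{\log\log\ell}$$ such that for at least $0.999\,|J|$ of the indices $j\in J$ there is a set $B_H=B_H(f_j)\subseteq[\ell]$ with $|B_H|=\lfloor(\log\ell)^{0.001}\rfloor$ such that $B_R\cup B_H$ can $0.999$-bias $f_j$ towards $1$.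 -/

import Mathlib

/-- `Pr[f = 1]` for a uniformly random input `x ∈ {0,1}^ℓ`. -/
noncomputable def prOne {ℓ : ℕ} (f : (Fin ℓ → Bool) → Bool) : ℝ :=
  ((Finset.univ.filter fun x : Fin ℓ → Bool => f x = true).card : ℝ) / 2 ^ ℓ

/-- The function `f|_B`, when the players in `B` are bad and push towards `1`: the players outside
`B` play their coordinates of `x`, and then the players in `B`, who see those coordinates, choose
theirs. The value is `1` exactly if they can make `f` equal to `1`. -/
def corrupt {ℓ : ℕ} (f : (Fin ℓ → Bool) → Bool) (B : Finset (Fin ℓ)) :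
    (Fin ℓ → Bool) → Bool :=
  fun x => decide (∃ y : Fin ℓ → Bool, (∀ i, i ∉ B → y i = x i) ∧ f y = true)

/-- `B` can `p`-bias `f` towards `1`: `Pr[f|_B = 1] ≥ p`. -/
def CanBias {ℓ : ℕ} (p : ℝ) (B : Finset (Fin ℓ)) (f : (Fin ℓ → Bool) → Bool) : Prop :=
  p ≤ prOne (corrupt f B)

/-!
The common set `B_R` and the sets `B_H` come from an optimisation. For a function `f` and a set `R`
let `biasPotential k f R` be the maximum over `H` of `Pr[f|_(R ∪ H) = 1] - |H| / k`, where
`k = ⌊(log ℓ) ^ 0.001⌋`. It lies in `[0, 1]`, so a maximiser `H` has at most `k` elements. Let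
`g = f|_(R ∪ H)` for such an `H`. By maximality no single player gains more than `1 / k` by joining
the adversary in `g`. If `R` together with at most `k` players never biases `f`, then `g` has
variance bounded below, and a Talagrand-type inequality (`variance_mul_log_le_sum_gain`) shows that
the gains of all players in `g` sum to at least a constant times `log k + 1`, hence at least a
constant times `log log ℓ`. The same gains are available when the players join `R` instead of `H`
(`log_le_sum_biasPotential_insert`).

Let `R` maximise the sum over the family of the potentials, less a price `lam` for each member of
`R`. As the sum of the potentials is at most `|J|`, the set `R` has at most `|J| / lam` elements.
If more than `0.001 |J|` of the functions were not biased, some player would raise the sum by more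
than `lam`, for `lam` of order `|J| log log ℓ / ℓ`. This contradicts maximality
(`exists_common_set`).

The Talagrand-type inequality is proved without Fourier analysis, following Falik and Samorodnitsky:
the entropy of the square of each martingale difference is bounded above by the logarithmic Sobolev
inequality (`cubeEnt_sq_le`) and below in terms of its `L¹` and `L²` norms (`le_cubeEnt_sq`). The
martingale is hidden in an induction on the number of coordinates (`variance_mul_log_le`).
-/

/-! ### Means and half-differences on the cube -/

/-- The mean of a real function on the discrete cube under the uniform measure. -/
noncomputable def cubeMean {n : ℕ} (f : (Fin n → Bool) → ℝ) : ℝ :=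
  (∑ x, f x) / 2 ^ n

/-- Half the difference of `f` between its values at `x i = true` and `x i = false`; this does not
depend on `x i`. -/
noncomputable def halfDiff {n : ℕ} (i : Fin n) (f : (Fin n → Bool) → ℝ) (x : Fin n → Bool) : ℝ :=
  (f (Function.update x i true) - f (Function.update x i false)) / 2

theorem cubeMean_succ {n : ℕ} (f : (Fin (n + 1) → Bool) → ℝ) :
    cubeMean f = (cubeMean (fun x : Fin n → Bool => f (Fin.cons true x)) +
      cubeMean (fun x : Fin n → Bool => f (Fin.cons false x))) / 2 := by
  unfold cubeMean
  rw [← (Fin.consEquiv (fun _ : Fin (n + 1) => Bool)).sum_comp, Fintype.sum_prod_type]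
  simp only [Fintype.sum_bool, Fin.consEquiv, Equiv.coe_fn_mk]
  rw [pow_succ]
  field_simp

theorem cubeMean_add {n : ℕ} (f g : (Fin n → Bool) → ℝ) :
    cubeMean (fun x => f x + g x) = cubeMean f + cubeMean g := by
  simp [cubeMean, Finset.sum_add_distrib, add_div]

theorem cubeMean_sub {n : ℕ} (f g : (Fin n → Bool) → ℝ) :
    cubeMean (fun x => f x - g x) = cubeMean f - cubeMean g := by
  simp [cubeMean, Finset.sum_sub_distrib, sub_div]

theorem cubeMean_const_mul {n : ℕ} (c : ℝ) (f : (Fin n → Bool) → ℝ) :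
    cubeMean (fun x => c * f x) = c * cubeMean f := by
  simp [cubeMean, ← Finset.mul_sum, mul_div_assoc]

theorem cubeMean_mono {n : ℕ} {f g : (Fin n → Bool) → ℝ} (h : ∀ x, f x ≤ g x) :
    cubeMean f ≤ cubeMean g := by
  unfold cubeMean
  gcongr
  exact h _

theorem cubeMean_nonneg {n : ℕ} {f : (Fin n → Bool) → ℝ} (h : ∀ x, 0 ≤ f x) :
    0 ≤ cubeMean f :=
  div_nonneg (Finset.sum_nonneg fun x _ => h x) (by positivity)

theorem eq_zero_of_cubeMean_eq_zero {n : ℕ} {f : (Fin n → Bool) → ℝ} (h : ∀ x, 0 ≤ f x)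
    (h0 : cubeMean f = 0) (x : Fin n → Bool) : f x = 0 := by
  unfold cubeMean at h0
  have h1 : ∑ x, f x = 0 := by
    rcases div_eq_zero_iff.1 h0 with h | h
    · exact h
    · exact absurd h (by positivity)
  exact (Finset.sum_eq_zero_iff_of_nonneg fun x _ => h x).1 h1 x (Finset.mem_univ x)

theorem cubeMean_mul_le_sqrt_mul_sqrt {n : ℕ} (f g : (Fin n → Bool) → ℝ) :
    cubeMean (fun x => f x * g x) ≤
      √(cubeMean fun x => f x ^ 2) * √(cubeMean fun x => g x ^ 2) := by
  unfold cubeMean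
  have h := Real.sum_mul_le_sqrt_mul_sqrt Finset.univ f g
  rw [Real.sqrt_div' _ (by positivity), Real.sqrt_div' _ (by positivity), div_mul_div_comm,
    Real.mul_self_sqrt (by positivity)]
  gcongr

theorem halfDiff_cons_succ {n : ℕ} (i : Fin n) (f : (Fin (n + 1) → Bool) → ℝ) (b : Bool)
    (x : Fin n → Bool) :
    halfDiff i.succ f (Fin.cons b x) = halfDiff i (fun y => f (Fin.cons b y)) x := by
  simp [halfDiff, Fin.cons_update]

theorem halfDiff_cons_zero {n : ℕ} (f : (Fin (n + 1) → Bool) → ℝ) (b : Bool) (x : Fin n → Bool) :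
    halfDiff 0 f (Fin.cons b x) = (f (Fin.cons true x) - f (Fin.cons false x)) / 2 := by
  simp [halfDiff]

/-! ### Entropy and the logarithmic Sobolev inequality -/

/-- The entropy functional `E[f log f] - E[f] log E[f]` of a nonnegative function on the cube, with
the convention `0 log 0 = 0`. -/
noncomputable def cubeEnt {n : ℕ} (f : (Fin n → Bool) → ℝ) : ℝ :=
  cubeMean (fun x => f x * Real.log (f x)) - cubeMean f * Real.log (cubeMean f)

theorem mul_log_le_mul_add {u m : ℝ} (hu : 0 ≤ u) (hm : 0 < m) :
    u * Real.log u ≤ u * (Real.log m + u / m - 1) := by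
  rcases hu.eq_or_lt with rfl | hu
  · simp
  · have h := Real.log_le_sub_one_of_pos (div_pos hu hm)
    rw [Real.log_div hu.ne' hm.ne'] at h
    exact mul_le_mul_of_nonneg_left (by linarith) hu.le

theorem mul_log_add_sub_le {u s : ℝ} (hu : 0 ≤ u) (hs : 0 < s) :
    u * Real.log s + u - s ≤ u * Real.log u := by
  rcases hu.eq_or_lt with rfl | hu
  · simpa using hs.le
  · have h := Real.log_le_sub_one_of_pos (div_pos hs hu)
    rw [Real.log_div hs.ne' hu.ne'] at h
    have h2 := mul_le_mul_of_nonneg_left h hu.le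
    have h3 : u * (s / u - 1) = s - u := by field_simp
    linarith

/-- The logarithmic Sobolev inequality on two points, with a constant twice the optimal one: this
weaker form follows from `log u ≤ u - 1`. -/
theorem two_point_log_sobolev (a b : ℝ) :
    (a ^ 2 * Real.log (a ^ 2) + b ^ 2 * Real.log (b ^ 2)) / 2 -
      (a ^ 2 + b ^ 2) / 2 * Real.log ((a ^ 2 + b ^ 2) / 2) ≤ (a - b) ^ 2 := by
  set m := (a ^ 2 + b ^ 2) / 2 with hm
  have hm0 : 0 ≤ m := by positivity
  rcases hm0.eq_or_lt with h0 | hpos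
  · have ha : a = 0 := by nlinarith [sq_nonneg a, sq_nonneg b]
    have hb : b = 0 := by nlinarith [sq_nonneg a, sq_nonneg b]
    simp [ha, hb, ← h0]
  · have h1 := mul_log_le_mul_add (sq_nonneg a) hpos
    have h2 := mul_log_le_mul_add (sq_nonneg b) hpos
    have h3 : (a ^ 2 * (a ^ 2 / m) + b ^ 2 * (b ^ 2 / m)) / 2 - m ≤ (a - b) ^ 2 := by
      have e : (a ^ 2 * (a ^ 2 / m) + b ^ 2 * (b ^ 2 / m)) / 2 = (a ^ 4 + b ^ 4) / 2 / m := by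
        field_simp
      rw [e, sub_le_iff_le_add, div_le_iff₀ hpos, hm]
      nlinarith [mul_nonneg (sq_nonneg (a - b)) (sq_nonneg (a - b))]
    have h4 : m * Real.log m = (a ^ 2 * Real.log m + b ^ 2 * Real.log m) / 2 := by
      rw [hm]; ring
    linarith

/-- The logarithmic Sobolev inequality on the cube. In the induction the entropy of the pair of
`L²` norms of the two halves is bounded by the two-point inequality, and the difference of these
norms by the norm of the difference. -/
theorem cubeEnt_sq_le {n : ℕ} (h : (Fin n → Bool) → ℝ) :
    cubeEnt (fun x => h x ^ 2) ≤ 4 * ∑ i, cubeMean (fun x => halfDiff i h x ^ 2) := by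
  induction n with
  | zero => simp [cubeEnt, cubeMean]
  | succ n ih =>
    have ih1 := ih fun x => h (Fin.cons true x)
    have ih0 := ih fun x => h (Fin.cons false x)
    have hcs := cubeMean_mul_le_sqrt_mul_sqrt (fun x : Fin n → Bool => h (Fin.cons true x))
      (fun x => h (Fin.cons false x))
    have hn1 : 0 ≤ cubeMean fun x : Fin n → Bool => h (Fin.cons true x) ^ 2 :=
      cubeMean_nonneg fun x => sq_nonneg _
    have hn0 : 0 ≤ cubeMean fun x : Fin n → Bool => h (Fin.cons false x) ^ 2 :=
      cubeMean_nonneg fun x => sq_nonneg _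
    have htp := two_point_log_sobolev (√(cubeMean fun x : Fin n → Bool => h (Fin.cons true x) ^ 2))
      (√(cubeMean fun x : Fin n → Bool => h (Fin.cons false x) ^ 2))
    rw [sub_sq, Real.sq_sqrt hn1, Real.sq_sqrt hn0] at htp
    have hd : cubeMean (fun x : Fin n → Bool =>
        ((h (Fin.cons true x) - h (Fin.cons false x)) / 2) ^ 2) * 4 =
        cubeMean (fun x : Fin n → Bool => h (Fin.cons true x) ^ 2) -
        2 * cubeMean (fun x : Fin n → Bool => h (Fin.cons true x) * h (Fin.cons false x)) +
        cubeMean (fun x : Fin n → Bool => h (Fin.cons false x) ^ 2) := by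
      rw [mul_comm, ← cubeMean_const_mul, ← cubeMean_const_mul, ← cubeMean_sub, ← cubeMean_add]
      congr 1
      ext x
      ring
    rw [Fin.sum_univ_succ]
    simp only [cubeEnt, cubeMean_succ (n := n), halfDiff_cons_succ, halfDiff_cons_zero] at *
    rw [← Finset.sum_div, Finset.sum_add_distrib]
    linarith

/-- A function whose `L¹` norm is small compared with its `L²` norm has large entropy. The bound
is linearised in these norms by means of the free parameter `t`. -/
theorem le_cubeEnt_sq {n : ℕ} (h : (Fin n → Bool) → ℝ) {t : ℝ} (ht : 0 < t) :
    cubeMean (fun x => h x ^ 2) * (Real.log t + 1) - t * cubeMean (fun x => |h x|) ^ 2 ≤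
      cubeEnt (fun x => h x ^ 2) := by
  have hv : 0 ≤ cubeMean fun x => h x ^ 2 := cubeMean_nonneg fun x => sq_nonneg _
  have ha : 0 ≤ cubeMean fun x => |h x| := cubeMean_nonneg fun x => abs_nonneg _
  unfold cubeEnt
  rcases ha.eq_or_lt with ha | ha
  · have h0 : ∀ x, h x = 0 := fun x =>
      abs_eq_zero.1 (eq_zero_of_cubeMean_eq_zero (fun x => abs_nonneg (h x)) ha.symm x)
    simp [h0, cubeMean]
  rcases hv.eq_or_lt with hv | hv
  · have h0 : ∀ x, h x = 0 := fun x =>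
      pow_eq_zero_iff two_ne_zero |>.1
        (eq_zero_of_cubeMean_eq_zero (fun x => sq_nonneg (h x)) hv.symm x)
    simp [h0, cubeMean] at ha
  set v := cubeMean fun x => h x ^ 2 with hvdef
  set a := cubeMean fun x => |h x| with hadef
  -- Jensen's inequality for `u ↦ u log u` under the density `|h| / a`.
  have h1 : 2 * ((Real.log (v / a) + 1) * v - v / a * a) ≤
      cubeMean fun x => h x ^ 2 * Real.log (h x ^ 2) := by
    rw [hvdef, hadef, ← cubeMean_const_mul, ← cubeMean_const_mul, ← cubeMean_sub,
      ← cubeMean_const_mul, ← hvdef, ← hadef]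
    refine cubeMean_mono fun x => ?_
    have h2 := mul_le_mul_of_nonneg_left
      (mul_log_add_sub_le (abs_nonneg (h x)) (div_pos hv ha)) (abs_nonneg (h x))
    rw [← sq_abs (h x), Real.log_pow]
    push_cast
    nlinarith
  rw [div_mul_cancel₀ _ ha.ne', Real.log_div hv.ne' ha.ne'] at h1
  have h2 := mul_log_add_sub_le hv.le (s := t * a ^ 2) (by positivity)
  rw [Real.log_mul ht.ne' (by positivity), Real.log_pow] at h2
  push_cast at h2
  linarith

/-! ### A Talagrand-type inequality -/

theorem halfDiff_avg {n : ℕ} (i : Fin n) (f g : (Fin n → Bool) → ℝ) (x : Fin n → Bool) :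
    halfDiff i (fun y => (f y + g y) / 2) x = (halfDiff i f x + halfDiff i g x) / 2 := by
  simp only [halfDiff]; ring

theorem halfDiff_halfSub {n : ℕ} (i : Fin n) (f g : (Fin n → Bool) → ℝ) (x : Fin n → Bool) :
    halfDiff i (fun y => (f y - g y) / 2) x = (halfDiff i f x - halfDiff i g x) / 2 := by
  simp only [halfDiff]; ring

/-- A Talagrand-type inequality. Averaging out one coordinate splits `f` into an average `g` and a
half-difference `d`. The variance and the energies are additive over this splitting, the entropy
bounds apply to `d`, and the induction hypothesis applies to `g`. -/
theorem variance_mul_log_le {n : ℕ} (f : (Fin n → Bool) → ℝ) {t : ℝ} (ht : 0 < t) :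
    (cubeMean (fun x => f x ^ 2) - cubeMean f ^ 2) * (Real.log t + 1) ≤
      4 * ∑ i, cubeMean (fun x => halfDiff i f x ^ 2) +
        t * ∑ i, cubeMean (fun x => |halfDiff i f x|) ^ 2 := by
  induction n with
  | zero => simp [cubeMean]
  | succ n ih =>
    set p : (Fin n → Bool) → ℝ := fun x => f (Fin.cons true x) with hp
    set q : (Fin n → Bool) → ℝ := fun x => f (Fin.cons false x) with hq
    set g : (Fin n → Bool) → ℝ := fun x => (p x + q x) / 2 with hg
    set d : (Fin n → Bool) → ℝ := fun x => (p x - q x) / 2 with hd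
    have ihg := ih g
    have hent := (le_cubeEnt_sq d ht).trans (cubeEnt_sq_le d)
    have par : ∀ u w : (Fin n → Bool) → ℝ,
        (cubeMean (fun x => u x ^ 2) + cubeMean (fun x => w x ^ 2)) / 2 =
          cubeMean (fun x => ((u x + w x) / 2) ^ 2) +
            cubeMean (fun x => ((u x - w x) / 2) ^ 2) := by
      intro u w
      rw [← cubeMean_add, ← cubeMean_add, div_eq_inv_mul, ← cubeMean_const_mul]
      congr 1
      ext x
      ring
    have hmean : cubeMean g = (cubeMean p + cubeMean q) / 2 := by
      rw [← cubeMean_add, div_eq_inv_mul, ← cubeMean_const_mul]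
      congr 1
      ext x
      simp only [hg]; ring
    have hsq : ∑ i : Fin n, cubeMean (fun x => halfDiff i.succ f x ^ 2) =
        ∑ i, cubeMean (fun x => halfDiff i g x ^ 2) +
          ∑ i, cubeMean (fun x => halfDiff i d x ^ 2) := by
      rw [← Finset.sum_add_distrib]
      refine Finset.sum_congr rfl fun i _ => ?_
      rw [cubeMean_succ]
      simp only [halfDiff_cons_succ, hg, hd, halfDiff_avg, halfDiff_halfSub]
      exact par _ _
    have habs : ∑ i, cubeMean (fun x => |halfDiff i g x|) ^ 2 ≤
        ∑ i : Fin n, cubeMean (fun x => |halfDiff i.succ f x|) ^ 2 := by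
      refine Finset.sum_le_sum fun i _ => ?_
      refine pow_le_pow_left₀ (cubeMean_nonneg fun x => abs_nonneg _) ?_ 2
      rw [cubeMean_succ, ← cubeMean_add, div_eq_inv_mul, ← cubeMean_const_mul]
      refine cubeMean_mono fun x => ?_
      simp only [halfDiff_cons_succ, hg, halfDiff_avg]
      rw [abs_div, abs_two, div_eq_inv_mul]
      gcongr
      exact abs_add_le _ _
    have h0 : cubeMean (fun x => |halfDiff 0 f x|) = cubeMean fun x => |d x| := by
      rw [cubeMean_succ]
      simp only [halfDiff_cons_zero, hd, hp, hq]
      ring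
    have h0' : 0 ≤ cubeMean (fun x => halfDiff 0 f x ^ 2) := cubeMean_nonneg fun x => sq_nonneg _
    have hvar : cubeMean (fun x => f x ^ 2) - cubeMean f ^ 2 =
        cubeMean (fun x => g x ^ 2) - cubeMean g ^ 2 + cubeMean (fun x => d x ^ 2) := by
      rw [hmean, cubeMean_succ f, cubeMean_succ fun x => f x ^ 2, par p q]
      ring
    rw [Fin.sum_univ_succ, Fin.sum_univ_succ, hsq, h0, hvar]
    nlinarith [mul_le_mul_of_nonneg_left habs ht.le]

/-! ### Corruption of Boolean functions -/

/-- The indicator of `f = 1` as a real function. -/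
noncomputable def boolInd {n : ℕ} (f : (Fin n → Bool) → Bool) (x : Fin n → Bool) : ℝ :=
  if f x then 1 else 0

theorem prOne_eq_cubeMean {n : ℕ} (f : (Fin n → Bool) → Bool) :
    prOne f = cubeMean (boolInd f) := by
  simp [prOne, cubeMean, boolInd]

theorem boolInd_sq {n : ℕ} (f : (Fin n → Bool) → Bool) (x : Fin n → Bool) :
    boolInd f x ^ 2 = boolInd f x := by
  unfold boolInd; split <;> norm_num

theorem prOne_nonneg {n : ℕ} (f : (Fin n → Bool) → Bool) : 0 ≤ prOne f := by
  unfold prOne; positivity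

theorem prOne_le_one {n : ℕ} (f : (Fin n → Bool) → Bool) : prOne f ≤ 1 := by
  unfold prOne
  rw [div_le_one (by positivity)]
  have h := Finset.card_filter_le Finset.univ fun x : Fin n → Bool => f x = true
  simp only [Finset.card_univ, Fintype.card_fun, Fintype.card_bool, Fintype.card_fin] at h
  exact_mod_cast h

theorem prOne_mono {n : ℕ} {f g : (Fin n → Bool) → Bool} (h : ∀ x, f x = true → g x = true) :
    prOne f ≤ prOne g := by
  unfold prOne
  exact div_le_div_of_nonneg_right
    (Nat.cast_le.2 (Finset.card_le_card (Finset.monotone_filter_right _ fun x _ => h x)))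
    (by positivity)

theorem corrupt_corrupt {n : ℕ} (f : (Fin n → Bool) → Bool) (B B' : Finset (Fin n)) :
    corrupt (corrupt f B) B' = corrupt f (B ∪ B') := by
  ext x
  rw [Bool.eq_iff_iff]
  simp only [corrupt, decide_eq_true_eq, Finset.mem_union, not_or]
  constructor
  · rintro ⟨y, hy, z, hz, hf⟩
    exact ⟨z, fun i hi => (hz i hi.1).trans (hy i hi.2), hf⟩
  · rintro ⟨z, hz, hf⟩
    refine ⟨fun i => if i ∈ B' then z i else x i, fun i hi => if_neg hi, z, fun i hi => ?_, hf⟩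
    by_cases h : i ∈ B'
    · simp [h]
    · simp [h, hz i ⟨hi, h⟩]

theorem prOne_corrupt_mono {n : ℕ} (f : (Fin n → Bool) → Bool) {B B' : Finset (Fin n)}
    (h : B ⊆ B') : prOne (corrupt f B) ≤ prOne (corrupt f B') := by
  refine prOne_mono fun x hx => ?_
  simp only [corrupt, decide_eq_true_eq] at hx ⊢
  obtain ⟨y, hy, hf⟩ := hx
  exact ⟨y, fun i hi => hy i fun hB => hi (h hB), hf⟩

theorem prOne_le_prOne_corrupt {n : ℕ} (f : (Fin n → Bool) → Bool) (B : Finset (Fin n)) :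
    prOne f ≤ prOne (corrupt f B) :=
  prOne_mono fun x hx => by simpa [corrupt] using ⟨x, fun _ _ => rfl, hx⟩

theorem corrupt_singleton {n : ℕ} (f : (Fin n → Bool) → Bool) (i : Fin n) (x : Fin n → Bool) :
    corrupt f {i} x = (f (Function.update x i true) || f (Function.update x i false)) := by
  rw [Bool.eq_iff_iff]
  simp only [corrupt, decide_eq_true_eq, Finset.mem_singleton, Bool.or_eq_true]
  constructor
  · rintro ⟨y, hy, hf⟩
    have hyx : y = Function.update x i (y i) := by
      ext j
      by_cases hj : j = i
      · subst hj; simp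
      · simp [hj, hy j hj]
    rw [hyx] at hf
    cases hb : y i <;> rw [hb] at hf
    · exact Or.inr hf
    · exact Or.inl hf
  · rintro (h | h)
    · exact ⟨_, fun j hj => Function.update_of_ne hj _ _, h⟩
    · exact ⟨_, fun j hj => Function.update_of_ne hj _ _, h⟩

theorem cubeMean_update_avg {n : ℕ} (i : Fin n) (f : (Fin n → Bool) → ℝ) :
    cubeMean (fun x => (f (Function.update x i true) + f (Function.update x i false)) / 2) =
      cubeMean f := by
  have hinv : Function.Involutive fun x : Fin n → Bool => Function.update x i (!x i) := by
    intro x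
    simp
  have hflip : cubeMean (fun x => f (Function.update x i (!x i))) = cubeMean f := by
    unfold cubeMean
    rw [← Equiv.sum_comp (hinv.toPerm _) f]
    rfl
  have hpt : (fun x => (f (Function.update x i true) + f (Function.update x i false)) / 2) =
      fun x => (1 / 2 : ℝ) * (f x + f (Function.update x i (!x i))) := by
    ext x
    have hx := Function.update_eq_self i x
    cases hb : x i <;> rw [hb] at hx <;> simp only [hx, Bool.not_false, Bool.not_true] <;> ring
  rw [hpt, cubeMean_const_mul, cubeMean_add, hflip]
  ring

/-! ### Gains of single players -/

/-- Handing one player to the adversary gains half the influence of that player. -/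
theorem prOne_corrupt_singleton {n : ℕ} (f : (Fin n → Bool) → Bool) (i : Fin n) :
    prOne (corrupt f {i}) - prOne f = cubeMean fun x => |halfDiff i (boolInd f) x| := by
  rw [prOne_eq_cubeMean, prOne_eq_cubeMean, ← cubeMean_update_avg i (boolInd f), ← cubeMean_sub]
  congr 1
  ext x
  simp only [boolInd, corrupt_singleton, halfDiff]
  cases f (Function.update x i true) <;> cases f (Function.update x i false) <;>
    norm_num [abs_of_pos, abs_of_neg]

theorem halfDiff_boolInd_sq {n : ℕ} (f : (Fin n → Bool) → Bool) (i : Fin n) (x : Fin n → Bool) :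
    halfDiff i (boolInd f) x ^ 2 = 1 / 2 * |halfDiff i (boolInd f) x| := by
  simp only [boolInd, halfDiff]
  cases f (Function.update x i true) <;> cases f (Function.update x i false) <;>
    norm_num [abs_of_pos, abs_of_neg]

/-- If no single player gains more than `1 / k`, the total gain of all players is at least of order
`log k`. -/
theorem variance_mul_log_le_sum_gain {n : ℕ} (f : (Fin n → Bool) → Bool) {k : ℝ} (hk : 0 < k)
    (hgain : ∀ i, prOne (corrupt f {i}) - prOne f ≤ 1 / k) :
    prOne f * (1 - prOne f) * (Real.log k + 1) ≤
      3 * ∑ i, (prOne (corrupt f {i}) - prOne f) := by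
  have h := variance_mul_log_le (boolInd f) hk
  simp only [boolInd_sq, halfDiff_boolInd_sq, cubeMean_const_mul, ← prOne_corrupt_singleton] at h
  change (cubeMean (boolInd f) - _) * _ ≤ _ at h
  rw [← prOne_eq_cubeMean, ← Finset.mul_sum, Finset.mul_sum (a := k)] at h
  have h2 : ∑ i, k * (prOne (corrupt f {i}) - prOne f) ^ 2 ≤
      ∑ i, (prOne (corrupt f {i}) - prOne f) := by
    refine Finset.sum_le_sum fun i _ => ?_
    have h0 : 0 ≤ prOne (corrupt f {i}) - prOne f := sub_nonneg.2 (prOne_le_prOne_corrupt f _)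
    have h1 := (le_div_iff₀ hk).1 (hgain i)
    nlinarith
  nlinarith

/-! ### The potential of a set of corrupted players -/

/-- The largest value, over all coalitions `H`, of the probability that `R ∪ H` forces `f = 1`,
less a price of `1 / k` for each member of `H`. -/
noncomputable def biasPotential {n : ℕ} (k : ℝ) (f : (Fin n → Bool) → Bool)
    (R : Finset (Fin n)) : ℝ :=
  Finset.univ.sup' Finset.univ_nonempty
    fun H : Finset (Fin n) => prOne (corrupt f (R ∪ H)) - H.card / k

theorem le_biasPotential {n : ℕ} (k : ℝ) (f : (Fin n → Bool) → Bool) (R H : Finset (Fin n)) :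
    prOne (corrupt f (R ∪ H)) - H.card / k ≤ biasPotential k f R :=
  Finset.le_sup' (fun H : Finset (Fin n) => prOne (corrupt f (R ∪ H)) - H.card / k)
    (Finset.mem_univ H)

theorem exists_eq_biasPotential {n : ℕ} (k : ℝ) (f : (Fin n → Bool) → Bool)
    (R : Finset (Fin n)) :
    ∃ H : Finset (Fin n), biasPotential k f R = prOne (corrupt f (R ∪ H)) - H.card / k := by
  obtain ⟨H, -, hH⟩ := Finset.exists_mem_eq_sup' Finset.univ_nonempty
    fun H : Finset (Fin n) => prOne (corrupt f (R ∪ H)) - H.card / k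
  exact ⟨H, hH⟩

theorem biasPotential_nonneg {n : ℕ} (k : ℝ) (f : (Fin n → Bool) → Bool) (R : Finset (Fin n)) :
    0 ≤ biasPotential k f R := by
  have h := le_biasPotential k f R ∅
  simp only [Finset.card_empty, Nat.cast_zero, zero_div, sub_zero] at h
  exact (prOne_nonneg _).trans h

theorem biasPotential_le_one {n : ℕ} {k : ℝ} (hk : 0 < k) (f : (Fin n → Bool) → Bool)
    (R : Finset (Fin n)) : biasPotential k f R ≤ 1 := by
  obtain ⟨H, hH⟩ := exists_eq_biasPotential k f R
  have h1 := prOne_le_one (corrupt f (R ∪ H))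
  have h2 : 0 ≤ (H.card : ℝ) / k := by positivity
  linarith

theorem biasPotential_mono {n : ℕ} (k : ℝ) (f : (Fin n → Bool) → Bool) {R R' : Finset (Fin n)}
    (h : R ⊆ R') : biasPotential k f R ≤ biasPotential k f R' := by
  obtain ⟨H, hH⟩ := exists_eq_biasPotential k f R
  have h1 := le_biasPotential k f R' H
  have h2 := prOne_corrupt_mono f (Finset.union_subset_union_left (t := H) h)
  linarith

/-- As long as no coalition of at most `k` players biases `f` together with `R`, enlarging `R` by a
uniformly random player raises the potential considerably on average. -/
theorem log_le_sum_biasPotential_insert {n : ℕ} {k : ℝ} (hk : 1 ≤ k)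
    (f : (Fin n → Bool) → Bool) (hf : (0.001 : ℝ) ≤ prOne f) (R : Finset (Fin n))
    (hbad : ∀ H : Finset (Fin n), (H.card : ℝ) ≤ k → ¬CanBias 0.999 (R ∪ H) f) :
    0.000999 * (Real.log k + 1) ≤
      3 * ∑ i, (biasPotential k f (insert i R) - biasPotential k f R) := by
  have hk0 : 0 < k := by linarith
  obtain ⟨H, hH⟩ := exists_eq_biasPotential k f R
  have hcard : (H.card : ℝ) ≤ k := by
    have h1 := biasPotential_nonneg k f R
    have h2 := prOne_le_one (corrupt f (R ∪ H))
    rw [← div_le_one hk0]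
    linarith
  have hlt : prOne (corrupt f (R ∪ H)) < 0.999 := not_le.1 (hbad H hcard)
  have hge : 0.001 ≤ prOne (corrupt f (R ∪ H)) := hf.trans (prOne_le_prOne_corrupt f _)
  -- The maximality of `H` bounds every single gain by the price of a player.
  have hgain : ∀ i, prOne (corrupt (corrupt f (R ∪ H)) {i}) - prOne (corrupt f (R ∪ H)) ≤
      1 / k := by
    intro i
    have h1 := le_biasPotential k f R (H ∪ {i})
    rw [hH, ← Finset.union_assoc] at h1
    have h2 : ((H ∪ {i}).card : ℝ) ≤ H.card + 1 := by
      exact_mod_cast (Finset.card_union_le H {i}).trans (by simp)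
    have h3 := div_le_div_of_nonneg_right h2 hk0.le
    rw [add_div] at h3
    rw [corrupt_corrupt]
    linarith
  have hsum := variance_mul_log_le_sum_gain (corrupt f (R ∪ H)) hk0 hgain
  have hpot : ∑ i, (prOne (corrupt (corrupt f (R ∪ H)) {i}) - prOne (corrupt f (R ∪ H))) ≤
      ∑ i, (biasPotential k f (insert i R) - biasPotential k f R) := by
    refine Finset.sum_le_sum fun i _ => ?_
    have h1 := le_biasPotential k f (insert i R) H
    have h2 : R ∪ H ∪ {i} = insert i R ∪ H := by
      ext j; simp only [Finset.mem_union, Finset.mem_singleton, Finset.mem_insert]; tauto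
    rw [corrupt_corrupt, h2]
    linarith
  have hlog : 0 ≤ Real.log k + 1 := by linarith [Real.log_nonneg hk]
  have hvar : 0.000999 ≤ prOne (corrupt f (R ∪ H)) * (1 - prOne (corrupt f (R ∪ H))) := by
    nlinarith
  nlinarith [mul_le_mul_of_nonneg_right hvar hlog]

/-! ### The common set -/

/-- A single set `R` serves most members of the family: choose `R` to maximise the total potential
less a price of `lam` for each member of `R`. -/
theorem exists_common_set {n : ℕ} {ι : Type*} [Fintype ι] [Nonempty ι] {k : ℝ} (hk : 1 ≤ k)
    (F : ι → (Fin n → Bool) → Bool) (hF : ∀ j, (0.001 : ℝ) ≤ prOne (F j)) :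
    ∃ R : Finset (Fin n), (R.card : ℝ) * (0.001 * 0.000333 * (Real.log k + 1)) ≤ n ∧
      (Set.ncard {j : ι | ∀ H : Finset (Fin n), (H.card : ℝ) ≤ k →
        ¬CanBias 0.999 (R ∪ H) (F j)} : ℝ) ≤ 0.001 * Fintype.card ι := by
  classical
  have hlog : 0 < Real.log k + 1 := by linarith [Real.log_nonneg hk]
  have hcard : (0 : ℝ) < Fintype.card ι := by exact_mod_cast Fintype.card_pos
  rcases Nat.eq_zero_or_pos n with rfl | hn
  · -- Without players the total gain is an empty sum, so no member of the family can be bad.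
    refine ⟨∅, by simp, ?_⟩
    have h0 : {j : ι | ∀ H : Finset (Fin 0), (H.card : ℝ) ≤ k →
        ¬CanBias 0.999 (∅ ∪ H) (F j)} = ∅ := by
      refine Set.eq_empty_of_forall_notMem fun j hj => ?_
      have h := log_le_sum_biasPotential_insert hk (F j) (hF j) ∅ hj
      simp only [Finset.univ_eq_empty, Finset.sum_empty] at h
      linarith
    rw [h0]
    rw [Set.ncard_empty, Nat.cast_zero]
    positivity
  have hn' : (0 : ℝ) < n := by exact_mod_cast hn
  set c : ℝ := 0.001 * 0.000333 * (Real.log k + 1) with hc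
  set lam : ℝ := c * Fintype.card ι / n with hlam
  obtain ⟨R, -, hR⟩ := Finset.exists_max_image Finset.univ
    (fun R : Finset (Fin n) => ∑ j, biasPotential k (F j) R - lam * R.card) Finset.univ_nonempty
  have hc0 : 0 < c := by positivity
  have hlam0 : 0 < lam := by positivity
  refine ⟨R, ?_, ?_⟩
  · have h1 := hR ∅ (Finset.mem_univ _)
    have h2 : 0 ≤ ∑ j, biasPotential k (F j) ∅ :=
      Finset.sum_nonneg fun j _ => biasPotential_nonneg k (F j) ∅
    have h3 : ∑ j, biasPotential k (F j) R ≤ ∑ _j : ι, (1 : ℝ) :=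
      Finset.sum_le_sum fun j _ => biasPotential_le_one (by linarith) (F j) R
    simp only [Finset.sum_const, Finset.card_univ, nsmul_eq_mul, mul_one, Finset.card_empty,
      Nat.cast_zero, mul_zero, sub_zero] at h1 h3
    have h4 : lam * R.card ≤ Fintype.card ι := by linarith
    rw [hlam, div_mul_eq_mul_div, div_le_iff₀ hn'] at h4
    refine le_of_mul_le_mul_left ?_ hcard
    linarith
  · set S : Finset ι := Finset.univ.filter fun j => ∀ H : Finset (Fin n), (H.card : ℝ) ≤ k →
        ¬CanBias 0.999 (R ∪ H) (F j) with hS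
    have hSn : {j : ι | ∀ H : Finset (Fin n), (H.card : ℝ) ≤ k →
        ¬CanBias 0.999 (R ∪ H) (F j)} = (S : Set ι) := by
      ext j; simp [hS]
    rw [hSn, Set.ncard_coe_finset]
    have hup : ∀ i, ∑ j, (biasPotential k (F j) (insert i R) - biasPotential k (F j) R) ≤
        lam := by
      intro i
      have h1 := hR (insert i R) (Finset.mem_univ _)
      have h2 : ((insert i R).card : ℝ) ≤ R.card + 1 := by
        exact_mod_cast Finset.card_insert_le i R
      have h3 := mul_le_mul_of_nonneg_left h2 hlam0.le
      rw [Finset.sum_sub_distrib]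
      linarith
    have hup' : ∑ i, ∑ j, (biasPotential k (F j) (insert i R) - biasPotential k (F j) R) ≤
        n * lam := by
      refine (Finset.sum_le_sum fun i _ => hup i).trans ?_
      simp
    have hlow : S.card * (0.000333 * (Real.log k + 1)) ≤
        ∑ j, ∑ i, (biasPotential k (F j) (insert i R) - biasPotential k (F j) R) := by
      calc S.card * (0.000333 * (Real.log k + 1))
          = ∑ _j ∈ S, 0.000333 * (Real.log k + 1) := by simp
        _ ≤ ∑ j ∈ S, ∑ i, (biasPotential k (F j) (insert i R) - biasPotential k (F j) R) := by
            refine Finset.sum_le_sum fun j hj => ?_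
            have h := log_le_sum_biasPotential_insert hk (F j) (hF j) R (by simpa [hS] using hj)
            linarith
        _ ≤ _ := by
            refine Finset.sum_le_sum_of_subset_of_nonneg (Finset.subset_univ _) fun j _ _ => ?_
            exact Finset.sum_nonneg fun i _ =>
              sub_nonneg.2 (biasPotential_mono k (F j) (Finset.subset_insert i R))
    rw [Finset.sum_comm] at hlow
    have h5 : (n : ℝ) * lam = c * Fintype.card ι := by
      rw [hlam]; field_simp
    have h6 : S.card * (0.000333 * (Real.log k + 1)) ≤
        0.001 * Fintype.card ι * (0.000333 * (Real.log k + 1)) := by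
      calc _ ≤ c * Fintype.card ι := by linarith
        _ = _ := by rw [hc]; ring
    exact le_of_mul_le_mul_right h6 (by positivity)

theorem one_lt_log_natCast {n : ℕ} (hn : 3 ≤ n) : 1 < Real.log n := by
  have h3 : (3 : ℝ) ≤ n := by exact_mod_cast hn
  rw [Real.lt_log_iff_exp_lt (by linarith)]
  linarith [Real.exp_one_lt_d9]

theorem mainTheorem2 :
    ∃ C : ℝ, 0 < C ∧
      ∀ (ℓ : ℕ), 3 ≤ ℓ →
      ∀ (ι : Type*) [Finite ι] (F : ι → (Fin ℓ → Bool) → Bool),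
        (∀ j, (0.001 : ℝ) ≤ prOne (F j)) →
        ∃ B_R : Finset (Fin ℓ),
          (B_R.card : ℝ) ≤ C * (ℓ / Real.log (Real.log ℓ)) ∧
          (0.999 : ℝ) * (Nat.card ι : ℝ) ≤
            (Set.ncard {j : ι | ∃ B_H : Finset (Fin ℓ),
              B_H.card = ⌊Real.log ℓ ^ (0.001 : ℝ)⌋₊ ∧
              CanBias 0.999 (B_R ∪ B_H) (F j)} : ℝ) := by
  refine ⟨4 * 10 ^ 9, by norm_num, fun ℓ hℓ ι _ F hF => ?_⟩
  have hL := one_lt_log_natCast hℓ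
  have hLL : 0 < Real.log (Real.log ℓ) := Real.log_pos hL
  rcases isEmpty_or_nonempty ι with hι | hι
  · exact ⟨∅, by simpa using by positivity, by simp⟩
  have := Fintype.ofFinite ι
  set k : ℕ := ⌊Real.log ℓ ^ (0.001 : ℝ)⌋₊ with hkdef
  have hpow : 1 ≤ Real.log ℓ ^ (0.001 : ℝ) := Real.one_le_rpow hL.le (by norm_num)
  have hk1 : 1 ≤ k := Nat.le_floor (by exact_mod_cast hpow)
  have hk1' : (1 : ℝ) ≤ k := by exact_mod_cast hk1
  have hkℓ : k ≤ ℓ := by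
    have h1 : (k : ℝ) ≤ Real.log ℓ ^ (0.001 : ℝ) := Nat.floor_le (by positivity)
    have h2 : Real.log ℓ ^ (0.001 : ℝ) ≤ Real.log ℓ :=
      Real.rpow_le_self_of_one_le hL.le (by norm_num)
    have h3 : Real.log ℓ ≤ ℓ := Real.log_le_self (by positivity)
    exact_mod_cast h1.trans (h2.trans h3)
  -- Rounding down costs at most a factor of two, which the summand `1` absorbs.
  have hlogk : 0.001 * Real.log (Real.log ℓ) ≤ Real.log k + 1 := by
    have h1 : Real.log ℓ ^ (0.001 : ℝ) ≤ 2 * k := by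
      have := Nat.lt_floor_add_one (Real.log ℓ ^ (0.001 : ℝ))
      rw [← hkdef] at this
      linarith
    have h2 := Real.log_le_log (by positivity) h1
    rw [Real.log_rpow (by positivity), Real.log_mul (by norm_num) (by positivity)] at h2
    linarith [Real.log_two_lt_d9]
  obtain ⟨R, hRcard, hbad⟩ := exists_common_set hk1' F hF
  refine ⟨R, ?_, ?_⟩
  · rw [mul_div_assoc', le_div_iff₀ hLL]
    have h1 := mul_le_mul_of_nonneg_left hlogk (Nat.cast_nonneg (α := ℝ) R.card)
    nlinarith
  · set good : Set ι := {j : ι | ∃ B_H : Finset (Fin ℓ),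
      B_H.card = k ∧ CanBias 0.999 (R ∪ B_H) (F j)} with hgood
    set bad : Set ι := {j : ι | ∀ H : Finset (Fin ℓ), (H.card : ℝ) ≤ k →
        ¬CanBias 0.999 (R ∪ H) (F j)} with hbaddef
    have hsub : goodᶜ ⊆ bad := by
      intro j hj H hH hbias
      refine hj ?_
      obtain ⟨H', hHH', -, hcard⟩ := Finset.exists_subsuperset_card_eq (Finset.subset_univ H)
        (by exact_mod_cast hH : H.card ≤ k) (by simpa using hkℓ)
      exact ⟨H', hcard, le_trans hbias
        (prOne_corrupt_mono (F j) (Finset.union_subset_union_right hHH'))⟩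
    have h1 : ((goodᶜ).ncard : ℝ) ≤ bad.ncard := by
      exact_mod_cast Set.ncard_le_ncard hsub
    have h2 : (good.ncard : ℝ) + (goodᶜ).ncard = Nat.card ι := by
      exact_mod_cast Set.ncard_add_ncard_compl good
    rw [← Nat.card_eq_fintype_card] at hbad
    linarith
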